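/- Let $q$ be a prime power and let $t,n_1,\dots,n_t,m_1,\dots,m_t$ be positive integers with $m_1\ge\dots\ge m_t$ and $m_i\ge n_i$ for all $i\in[t]=\{1,\dots,t\}$. Put $n=n_1+\dots+n_t$ and $\mathbb M=\mathbb F_q^{m_1\times n_1}\times\dots\times\mathbb F_q^{m_t\times n_t}$. For $C=(C_1,\dots,C_t)\in\mathbb M$ let $\mathrm{srk}(C)=\sum_{i=1}^t\mathrm{rk}(C_i)$. A code is an $\mathbb F_q$-linear subspace of $\mathbb M$; the minimum distance of a code $\mathcal C\neq 0$ is $d(\mathcal C)=\min\{\mathrm{srk}(C): C\in\mathcal C\setminus 0\}$. A nonzero code $\mathcal C$ is MSRD (maximum sum-rank distance) if there are $k\in[t]$ and $0\le\varepsilon\le n_k-1$ with $d(\mathcal C)=\sum_{i=1}^{k-1}n_i+\varepsilon+1$ and $\dim_{\mathbb F_q}(\mathcal C)=\sum_{i=k}^t m_in_i-\varepsilon m_k$. Let $j=\min\{i\in[t]: m_i=m_t\}$, let $0\le\delta\le n_j-1$, and let $d=\sum_{i=1}^{j-1}n_i+\delta+1$. Suppose that the set $\{i\in[t]: n_i>m_t\}$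 is non-empty, let $h$ be its maximum, and assume that $$m_h\ge m_t\left(\sum_{i=j}^t n_i-\delta\right)\quad\text{and}\quad q>t-h.$$ Then there exist MSRD codes $\mathcal C_n\subseteq\dots\subseteq\mathcal C_{d+1}\subseteq\mathcal C_d\subseteq\mathbb M$ with $d(\mathcal C_i)=i$ for all $d\le i\le n$. -/

import Mathlib

/-- The ambient space `F^{m₁ × n₁} × ⋯ × F^{m_t × n_t}`; the blocks are indexed by `Fin t`. -/
abbrev MatTuple (F : Type*) {t : ℕ} (m n : Fin t → ℕ) : Type _ :=
  (i : Fin t) → Matrix (Fin (m i)) (Fin (n i)) F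

/-- The sum-rank weight: the sum of the ranks of the components. -/
noncomputable def srk {F : Type*} [Field F] {t : ℕ} {m n : Fin t → ℕ}
    (X : MatTuple F m n) : ℕ :=
  ∑ i, (X i).rank

/-- The minimum distance of a nonzero linear sum-rank metric code: the least sum-rank weight of
a nonzero codeword. (The zero code has no minimum distance; here it gets the value `0`, which is
not attained by any nonzero code.) -/
noncomputable def minDist {F : Type*} [Field F] {t : ℕ} {m n : Fin t → ℕ}
    (C : Submodule F (MatTuple F m n)) : ℕ :=
  sInf {w | ∃ X ∈ C, X ≠ 0 ∧ srk X = w}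

/-- A nonzero linear code `C` is maximum sum-rank distance (MSRD) if for some block `j` and some
`0 ≤ δ ≤ n_j - 1` its minimum distance is `∑_{i < j} n_i + δ + 1` and its dimension over `F` is
`∑_{i ≥ j} m_i n_i - δ m_j`. (The subtraction is written as an addition on the other side.) -/
def IsMSRD {F : Type*} [Field F] {t : ℕ} {m n : Fin t → ℕ}
    (C : Submodule F (MatTuple F m n)) : Prop :=
  C ≠ ⊥ ∧ ∃ (j : Fin t) (δ : ℕ), δ < n j ∧
    minDist C = (∑ i ∈ Finset.Iio j, n i) + δ + 1 ∧
    Module.finrank F C + δ * m j = ∑ i ∈ Finset.Ici j, m i * n i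

/-!
Let `K` be the extension of `F` of degree `m_t`. A skew polynomial of degree less than `s` over `K`
is encoded blockwise. On the blocks after `h`, where `n_l ≤ m_t`, it is evaluated at the operators
`x ↦ a_l * x ^ q` of `K`, where the `a_l` have pairwise distinct norms in `F`; this is possible
because there are fewer than `q` such blocks. Every right division by a linear factor `x - b` lowers
the total dimension of the kernels of these evaluations by at most one, since the `a_l` are pairwise
non-conjugate, so the total rank defect is at most the degree. The blocks up to `h` may be too wide
for this, but there `m_l` is at least the dimension of the space of messages, so multiplication in
an extension of degree `m_l` gives a linear family of matrices of full rank without any defect.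

The filtration by degree is the chain of codes. That no larger distance is possible follows by
prescribing zero columns inside the narrowest blocks, each of which costs `m_t` linear conditions.
-/

open Module Polynomial

section LinearAlgebra

variable {F V W : Type*} [Field F] [AddCommGroup V] [Module F V] [FiniteDimensional F V]
  [AddCommGroup W] [Module F W]

theorem finrank_comap_le (f : V →ₗ[F] W) (q : Submodule F W) [FiniteDimensional F q] :
    finrank F (q.comap f) ≤ finrank F q + finrank F (LinearMap.ker f) := by
  have hker : finrank F (LinearMap.ker (f.domRestrict (q.comap f))) = finrank F (LinearMap.ker f) :=
    (Submodule.comapSubtypeEquivOfLe (Submodule.comap_mono bot_le)).finrank_eq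
  rw [← (f.domRestrict (q.comap f)).finrank_range_add_finrank_ker, hker]
  refine Nat.add_le_add_right (Submodule.finrank_mono ?_) _
  rintro _ ⟨x, rfl⟩
  exact x.2

theorem finrank_ker_comp_of_injective_le {V' W' : Type*} [AddCommGroup V'] [Module F V']
    [AddCommGroup W'] [Module F W'] {f : V' →ₗ[F] V} (hf : Function.Injective f)
    (g : V →ₗ[F] W) {e : W →ₗ[F] W'} (he : Function.Injective e) :
    finrank F (LinearMap.ker (e ∘ₗ g ∘ₗ f)) ≤ finrank F (LinearMap.ker g) := by
  rw [LinearMap.ker_comp_of_ker_eq_bot _ (LinearMap.ker_eq_bot.mpr he), LinearMap.ker_comp]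
  exact LinearMap.finrank_le_finrank_of_injective
    (f := f.submoduleComap (LinearMap.ker g)) fun x y hxy ↦
      Subtype.ext (hf (congrArg Subtype.val hxy))

/-- Compressing along injections `Fⁿ → V` and `W → Fᴹ` turns linear maps into matrices without
increasing the nullity. -/
theorem exists_linearMap_le_rank_add_finrank_ker [FiniteDimensional F W] {M n : ℕ}
    (hn : n ≤ finrank F V) (hM : finrank F W ≤ M) :
    ∃ φ : (V →ₗ[F] W) →ₗ[F] Matrix (Fin M) (Fin n) F,
      ∀ g, n ≤ (φ g).rank + finrank F (LinearMap.ker g) := by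
  obtain ⟨f, hf⟩ := finrank_le_iff_exists_linearMap (R := F) (M := Fin n → F) (M' := V) |>.mp
    (by rwa [finrank_fin_fun])
  obtain ⟨e, he⟩ := finrank_le_iff_exists_linearMap (R := F) (M := W) (M' := Fin M → F) |>.mp
    (by rwa [finrank_fin_fun])
  refine ⟨LinearMap.toMatrix'.toLinearMap ∘ₗ e.compRight F ∘ₗ f.lcomp F W, fun g ↦ ?_⟩
  change n ≤ (LinearMap.toMatrix' (e ∘ₗ g ∘ₗ f)).rank + _
  have hrank := (e ∘ₗ g ∘ₗ f).finrank_range_add_finrank_ker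
  rw [finrank_fin_fun] at hrank
  rw [Matrix.rank, ← Matrix.toLin'_apply', Matrix.toLin'_toMatrix']
  exact hrank.ge.trans (Nat.add_le_add_left (finrank_ker_comp_of_injective_le hf g he) _)

end LinearAlgebra

theorem exists_finiteField_extension_finrank_eq (F : Type*) [Field F] [Finite F] {r : ℕ}
    (hr : r ≠ 0) : ∃ (K : Type) (_ : Field K) (_ : Algebra F K) (_ : Finite K),
      finrank F K = r := by
  obtain ⟨p, _⟩ := CharP.exists F
  have : Fact p.Prime := ⟨CharP.char_is_prime F p⟩
  have : NeZero r := ⟨hr⟩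
  exact ⟨FiniteField.Extension F p r, inferInstance, inferInstance, inferInstance,
    FiniteField.finrank_extension F p r⟩

theorem exists_linearMap_matrix_rank_eq {F V : Type*} [Field F] [Finite F] [AddCommGroup V]
    [Module F V] [FiniteDimensional F V] {M n : ℕ} (hn : n ≤ M) (hV : finrank F V ≤ M) :
    ∃ φ : V →ₗ[F] Matrix (Fin M) (Fin n) F, ∀ v, v ≠ 0 → (φ v).rank = n := by
  rcases eq_or_ne M 0 with rfl | hM
  · exact ⟨0, fun v _ ↦ by simp [Nat.le_zero.mp hn]⟩
  obtain ⟨K, _, _, _, hK⟩ := exists_finiteField_extension_finrank_eq F hM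
  obtain ⟨i, hi⟩ := finrank_le_iff_exists_linearMap (R := F) (M := V) (M' := K) |>.mp
    (hK.symm ▸ hV)
  obtain ⟨φ, hφ⟩ := exists_linearMap_le_rank_add_finrank_ker (F := F) (V := K) (W := K)
    (hK.symm ▸ hn) hK.le
  refine ⟨φ ∘ₗ LinearMap.mul F K ∘ₗ i, fun v hv ↦ le_antisymm (Matrix.rank_le_width _) ?_⟩
  have hker : LinearMap.ker (LinearMap.mul F K (i v)) = ⊥ :=
    LinearMap.ker_eq_bot.mpr (mul_right_injective₀ ((map_ne_zero_iff i hi).mpr hv))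
  have hdefect := hφ (LinearMap.mul F K (i v))
  rwa [hker, finrank_bot, add_zero] at hdefect

section SkewPolynomial

variable {F K : Type*} [Field F] [Field K] [Algebra F K]

/-- The `σ`-semilinear operator `x ↦ a * σ x` of `K`. -/
noncomputable def skewShift (σ : K ≃ₐ[F] K) (a : K) : End F K :=
  a • σ.toLinearMap

/-- The operator `∑ fₖ Tᵏ` obtained by evaluating the skew polynomial `∑ fₖ xᵏ` of `K[x; σ]` at
`T = skewShift σ a`. Only the left `K`-linear structure of `K[x; σ]` is needed, so a skew polynomial
is encoded by its coefficients, as an element of the commutative polynomial ring `K[X]`. -/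
noncomputable def skewEval (σ : K ≃ₐ[F] K) (a : K) : K[X] →ₗ[K] End F K :=
  Polynomial.lsum fun k ↦ LinearMap.toSpanSingleton K (End F K) (skewShift σ a ^ k)

/-- `σ`-conjugacy in the sense of Lam and Leroy, with the division by `y` cleared:
`b = a * σ y / y`. -/
def SkewConj (σ : K ≃ₐ[F] K) (a b : K) : Prop :=
  ∃ y ≠ 0, a * σ y = b * y

variable (σ : K ≃ₐ[F] K)

theorem skewShift_apply (a x : K) : skewShift σ a x = a * σ x := rfl

theorem skewEval_monomial (a c : K) (k : ℕ) :
    skewEval σ a (monomial k c) = c • skewShift σ a ^ k := by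
  simp [skewEval, Polynomial.lsum_apply, sum_monomial_index]

theorem skewEval_C (a c : K) : skewEval σ a (C c) = c • 1 := by
  rw [← monomial_zero_left, skewEval_monomial, pow_zero]

theorem skewShift_pow_mul_smul_one (a b : K) (k : ℕ) :
    skewShift σ a ^ k * (b • 1) = (σ ^ k) b • skewShift σ a ^ k := by
  induction k with
  | zero => simp
  | succ k ih =>
    rw [pow_succ', mul_assoc, ih]
    ext x
    simp only [Module.End.mul_apply, LinearMap.smul_apply, skewShift_apply, smul_eq_mul, map_mul,
      pow_succ', AlgEquiv.mul_apply]
    ring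

theorem skewEval_monomial_succ (a b c : K) (k : ℕ) :
    skewEval σ a (monomial (k + 1) c) =
      skewEval σ a (monomial k c) * (skewShift σ a - b • 1) +
        skewEval σ a (monomial k (c * (σ ^ k) b)) := by
  simp only [skewEval_monomial, mul_sub, smul_mul_assoc, skewShift_pow_mul_smul_one, pow_succ,
    mul_smul, sub_add_cancel]

/-- Right division by `x - b`. The quotient and the remainder do not depend on the evaluation
point. -/
theorem exists_skewEval_eq_mul_add (b : K) {s : ℕ} {f : K[X]} (hf : f.natDegree ≤ s + 1) :
    ∃ (g : K[X]) (c : K), g.natDegree ≤ s ∧ g.coeff s = f.coeff (s + 1) ∧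
      ∀ a, skewEval σ a f = skewEval σ a g * (skewShift σ a - b • 1) + c • 1 := by
  induction s generalizing f with
  | zero =>
    refine ⟨C (f.coeff 1), f.coeff 1 * b + f.coeff 0, natDegree_C _ |>.le, coeff_C_zero, fun a ↦ ?_⟩
    nth_rw 1 [eq_X_add_C_of_natDegree_le_one hf]
    rw [map_add, C_mul_X_eq_monomial, skewEval_monomial_succ σ a b]
    simp only [monomial_zero_left, skewEval_C, pow_zero, AlgEquiv.one_apply, add_smul, add_assoc]
  | succ s ih =>
    set c := f.coeff (s + 2)
    obtain ⟨g, r, hg, -, hfg⟩ := ih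
      (f := f - monomial (s + 2) c + monomial (s + 1) (c * (σ ^ (s + 1)) b)) <| by
        refine natDegree_add_le_of_degree_le ?_ (natDegree_monomial_le _)
        rw [natDegree_le_iff_coeff_eq_zero]
        intro k hk
        rcases (Nat.succ_le_of_lt hk).eq_or_lt with rfl | hk
        · simp [c]
        · rw [coeff_sub, coeff_eq_zero_of_natDegree_lt (hf.trans_lt hk),
            coeff_monomial_of_ne _ hk.ne', sub_zero]
    refine ⟨monomial (s + 1) c + g, r,
      natDegree_add_le_of_degree_le (natDegree_monomial_le _) (hg.trans s.le_succ), ?_, fun a ↦ ?_⟩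
    · rw [coeff_add, coeff_monomial_same, coeff_eq_zero_of_natDegree_lt (Nat.lt_succ_of_le hg),
        add_zero]
    · have h := hfg a
      rw [map_add, map_sub, skewEval_monomial_succ σ a b] at h
      rw [map_add, add_mul, add_assoc, ← h]
      abel

theorem exists_skewEval_eq_mul_of_apply_eq_zero {f : K[X]} (hf : f ≠ 0) {a₀ y : K} (hy : y ≠ 0)
    (hfy : skewEval σ a₀ f y = 0) :
    ∃ (g : K[X]) (b : K), g ≠ 0 ∧ g.natDegree < f.natDegree ∧
      ∀ a, skewEval σ a f = skewEval σ a g * (skewShift σ a - b • 1) := by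
  obtain ⟨s, hs⟩ : ∃ s, f.natDegree = s + 1 := by
    refine Nat.exists_eq_succ_of_ne_zero fun h0 ↦ hf ?_
    obtain ⟨c, rfl⟩ := natDegree_eq_zero.mp h0
    have hc : c * y = 0 := by simpa [skewEval_C] using hfy
    rw [(mul_eq_zero.mp hc).resolve_right hy, C_0]
  set b := a₀ * σ y / y with hb
  obtain ⟨g, c, hg, hcoeff, hdiv⟩ := exists_skewEval_eq_mul_add σ b hs.le
  have hTy : (skewShift σ a₀ - b • 1) y = 0 := by simp [skewShift_apply, hb, hy]
  have hc : c * y = 0 := by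
    simpa only [hdiv, LinearMap.add_apply, Module.End.mul_apply, hTy, map_zero, zero_add] using! hfy
  refine ⟨g, b, ?_, by omega, fun a ↦ ?_⟩
  · rintro rfl
    rw [coeff_zero, ← hs, coeff_natDegree] at hcoeff
    exact hf (leadingCoeff_eq_zero.mp hcoeff.symm)
  · rw [hdiv, (mul_eq_zero.mp hc).resolve_right hy, zero_smul, add_zero]

variable {σ}

theorem mem_ker_skewShift_sub_smul_one {a b x : K} :
    x ∈ LinearMap.ker (skewShift σ a - b • 1) ↔ a * σ x = b * x :=
  sub_eq_zero

theorem ker_skewShift_sub_smul_one_eq_bot {a b : K} (h : ¬ SkewConj σ a b) :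
    LinearMap.ker (skewShift σ a - b • 1) = ⊥ := by
  refine (Submodule.eq_bot_iff _).mpr fun x hx ↦ ?_
  by_contra hx0
  exact h ⟨x, hx0, mem_ker_skewShift_sub_smul_one.mp hx⟩

theorem finrank_ker_skewShift_sub_smul_one_le_one
    (hσ : ∀ x, σ x = x → x ∈ Set.range (algebraMap F K)) {a : K} (ha : a ≠ 0) (b : K) :
    finrank F (LinearMap.ker (skewShift σ a - b • 1)) ≤ 1 := by
  by_cases hconj : SkewConj σ a b
  swap
  · rw [ker_skewShift_sub_smul_one_eq_bot hconj, finrank_bot]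
    exact zero_le_one
  obtain ⟨y, hy0, hy⟩ := hconj
  refine finrank_le_one ⟨y, mem_ker_skewShift_sub_smul_one.mpr hy⟩ fun ⟨x, hx⟩ ↦ ?_
  rw [mem_ker_skewShift_sub_smul_one] at hx
  have hfix : σ (x / y) = x / y := by
    rw [map_div₀, div_eq_div_iff ((map_ne_zero σ).mpr hy0) hy0]
    apply mul_left_cancel₀ ha
    linear_combination y * hx - x * hy
  obtain ⟨c, hc⟩ := hσ _ hfix
  refine ⟨c, Subtype.ext ?_⟩
  change c • y = x
  rw [Algebra.smul_def, hc, div_mul_cancel₀ _ hy0]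

theorem SkewConj.of_common_right {a a' b : K} (h : SkewConj σ a b) (h' : SkewConj σ a' b) :
    SkewConj σ a a' := by
  obtain ⟨y, hy0, hy⟩ := h
  obtain ⟨z, hz0, hz⟩ := h'
  refine ⟨y / z, div_ne_zero hy0 hz0, ?_⟩
  have hσz : σ z ≠ 0 := (map_ne_zero σ).mpr hz0
  rw [map_div₀]
  field_simp
  linear_combination z * hy - y * hz

theorem SkewConj.norm_eq [FiniteDimensional F K] {a b : K} (h : SkewConj σ a b) :
    Algebra.norm F a = Algebra.norm F b := by
  obtain ⟨y, hy0, hy⟩ := h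
  have hnorm := congrArg (Algebra.norm F) hy
  rw [map_mul, map_mul, Algebra.norm_eq_of_algEquiv] at hnorm
  exact mul_right_cancel₀ (Algebra.norm_ne_zero_iff.mpr hy0) hnorm

section RootCount

variable {ι : Type*} {S : Finset ι} {a : ι → K}

theorem sum_finrank_ker_skewShift_sub_smul_one_le_one
    (hσ : ∀ x, σ x = x → x ∈ Set.range (algebraMap F K)) (ha : ∀ i ∈ S, a i ≠ 0)
    (hconj : (S : Set ι).Pairwise fun i i' ↦ ¬ SkewConj σ (a i) (a i')) (b : K) :
    ∑ i ∈ S, finrank F (LinearMap.ker (skewShift σ (a i) - b • 1)) ≤ 1 := by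
  by_cases h : ∃ i ∈ S, SkewConj σ (a i) b
  · obtain ⟨i, hi, hib⟩ := h
    rw [Finset.sum_eq_single_of_mem i hi fun i' hi' hne ↦ by
      rw [ker_skewShift_sub_smul_one_eq_bot fun h' ↦ hconj hi' hi hne (h'.of_common_right hib),
        finrank_bot]]
    exact finrank_ker_skewShift_sub_smul_one_le_one hσ (ha i hi) b
  · push Not at h
    rw [Finset.sum_eq_zero fun i hi ↦ by
      rw [ker_skewShift_sub_smul_one_eq_bot (h i hi), finrank_bot]]
    exact zero_le_one

theorem sum_finrank_ker_skewEval_le_natDegree [FiniteDimensional F K]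
    (hσ : ∀ x, σ x = x → x ∈ Set.range (algebraMap F K)) (ha : ∀ i ∈ S, a i ≠ 0)
    (hconj : (S : Set ι).Pairwise fun i i' ↦ ¬ SkewConj σ (a i) (a i')) {f : K[X]} (hf : f ≠ 0) :
    ∑ i ∈ S, finrank F (LinearMap.ker (skewEval σ (a i) f)) ≤ f.natDegree := by
  induction hs : f.natDegree using Nat.strong_induction_on generalizing f with
  | _ s ih =>
    subst hs
    by_cases hall : ∀ i ∈ S, LinearMap.ker (skewEval σ (a i) f) = ⊥
    · rw [Finset.sum_eq_zero fun i hi ↦ by rw [hall i hi, finrank_bot]]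
      exact Nat.zero_le _
    push Not at hall
    obtain ⟨i₀, -, hi₀⟩ := hall
    obtain ⟨y, hy, hy0⟩ := Submodule.exists_mem_ne_zero_of_ne_bot hi₀
    obtain ⟨g, b, hg, hdeg, hfg⟩ := exists_skewEval_eq_mul_of_apply_eq_zero σ hf hy0 hy
    calc ∑ i ∈ S, finrank F (LinearMap.ker (skewEval σ (a i) f))
        ≤ ∑ i ∈ S, (finrank F (LinearMap.ker (skewEval σ (a i) g)) +
            finrank F (LinearMap.ker (skewShift σ (a i) - b • 1))) :=
          Finset.sum_le_sum fun i _ ↦ by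
            rw [hfg, Module.End.mul_eq_comp, LinearMap.ker_comp]
            exact finrank_comap_le _ _
      _ ≤ g.natDegree + 1 := by
          rw [Finset.sum_add_distrib]
          exact add_le_add (ih _ hdeg hg rfl)
            (sum_finrank_ker_skewShift_sub_smul_one_le_one hσ ha hconj b)
      _ ≤ f.natDegree := hdeg

end RootCount

end SkewPolynomial

section Encoder

variable {F K : Type*} [Field F] [Field K] [Algebra F K] {t : ℕ} {m n : Fin t → ℕ}

theorem mem_range_algebraMap_of_frobenius_eq [Fintype F] [Finite K] {x : K}
    (hx : FiniteField.frobeniusAlgEquivOfAlgebraic F K x = x) : x ∈ Set.range (algebraMap F K) := by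
  rw [IsGalois.mem_range_algebraMap_iff_fixed]
  intro g
  obtain ⟨k, rfl⟩ := (FiniteField.bijective_frobeniusAlgEquivOfAlgebraic_pow F K).2 g
  simpa only [AlgEquiv.coe_pow] using! Function.iterate_fixed hx _

theorem exists_pairwise_not_skewConj [Fintype F] [Finite K] {ι : Type*} (σ : K ≃ₐ[F] K)
    {S : Finset ι} (hS : S.card < Fintype.card F) :
    ∃ a : ι → K, (∀ i, a i ≠ 0) ∧
      (S : Set ι).Pairwise fun i i' ↦ ¬ SkewConj σ (a i) (a i') := by
  classical
  obtain ⟨u, -, hu⟩ := S.finite_toSet.exists_injOn_of_encard_le (t := (Set.univ : Set Fˣ)) <| by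
    rw [Set.encard_coe_eq_coe_finsetCard, Set.encard_univ, ENat.card_eq_coe_fintype_card,
      Fintype.card_units]
    exact_mod_cast Nat.le_sub_one_of_lt hS
  choose a ha using fun i ↦ FiniteField.norm_surjective F K (u i : F)
  refine ⟨a, fun i hi ↦ (u i).ne_zero (by rw [← ha i, hi, Algebra.norm_zero]),
    fun i hi i' hi' hne hconj ↦ hne (hu hi hi' (Units.ext ?_))⟩
  rw [← ha i, ← ha i', hconj.norm_eq]

/-- `E` encodes skew polynomials of degree less than `N`, with the degree of the message bounding
the rank defect `∑ nₗ - srk` of its codeword, as for linearized Reed–Solomon codes. -/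
def IsSumRankEncoder (E : K[X] →ₗ[F] MatTuple F m n) (N : ℕ) : Prop :=
  ∀ f : K[X], f ≠ 0 → f.natDegree < N → ∑ l, n l ≤ srk (E f) + f.natDegree

/-- The code consisting of the codewords of the skew polynomials of degree less than `s`. -/
noncomputable def encodedCode (E : K[X] →ₗ[F] MatTuple F m n) (s : ℕ) :
    Submodule F (MatTuple F m n) :=
  ((degreeLT K s).restrictScalars F).map E

theorem finrank_degreeLT (N : ℕ) :
    finrank F ((degreeLT K N).restrictScalars F) = finrank F K * N := by
  refine ((degreeLTEquiv K N).restrictScalars F).finrank_eq.trans ?_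
  rw [← finrank_mul_finrank F K, finrank_fin_fun]

theorem exists_linearMap_matrix_rank_eq_of_degreeLT [Finite F] [FiniteDimensional F K]
    {M c N : ℕ} (hc : c ≤ M) (hM : finrank F K * N ≤ M) :
    ∃ φ : K[X] →ₗ[F] Matrix (Fin M) (Fin c) F,
      ∀ f : K[X], f ≠ 0 → f.natDegree < N → (φ f).rank = c := by
  let P := (degreeLT K N).restrictScalars F
  have : FiniteDimensional F P :=
    ((degreeLTEquiv K N).restrictScalars F).symm.finiteDimensional
  obtain ⟨ψ, hψ⟩ := exists_linearMap_matrix_rank_eq (V := P) hc ((finrank_degreeLT N).trans_le hM)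
  obtain ⟨φ, rfl⟩ := ψ.exists_extend
  refine ⟨φ, fun f hf hfN ↦ hψ ⟨f, ?_⟩ fun h ↦ hf (congrArg Subtype.val h)⟩
  exact mem_degreeLT.mpr ((natDegree_lt_iff_degree_lt hf).mp hfN)

/-- The blocks in `S` carry a linearized Reed–Solomon code, the others matrices of full rank. -/
theorem exists_isSumRankEncoder [Fintype F] [Finite K] {N : ℕ} {S : Finset (Fin t)}
    (hcard : S.card < Fintype.card F)
    (hS : ∀ l ∈ S, n l ≤ finrank F K ∧ finrank F K ≤ m l)
    (hSc : ∀ l ∉ S, n l ≤ m l ∧ finrank F K * N ≤ m l) :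
    ∃ E : K[X] →ₗ[F] MatTuple F m n, IsSumRankEncoder E N := by
  classical
  let σ := FiniteField.frobeniusAlgEquivOfAlgebraic F K
  obtain ⟨a, ha0, hconj⟩ := exists_pairwise_not_skewConj σ hcard
  have hblock : ∀ l, ∃ φ : K[X] →ₗ[F] Matrix (Fin (m l)) (Fin (n l)) F,
      ∀ f : K[X], f ≠ 0 → f.natDegree < N → n l ≤ (φ f).rank +
        if l ∈ S then finrank F (LinearMap.ker (skewEval σ (a l) f)) else 0 := by
    intro l
    by_cases hl : l ∈ S
    · obtain ⟨φ, hφ⟩ := exists_linearMap_le_rank_add_finrank_ker (hS l hl).1 (hS l hl).2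
      refine ⟨φ ∘ₗ (skewEval σ (a l)).restrictScalars F, fun f _ _ ↦ ?_⟩
      rw [if_pos hl]
      exact hφ _
    · obtain ⟨φ, hφ⟩ := exists_linearMap_matrix_rank_eq_of_degreeLT (hSc l hl).1 (hSc l hl).2
      exact ⟨φ, fun f hf hfN ↦ by rw [if_neg hl, add_zero, hφ f hf hfN]⟩
  choose φ hφ using hblock
  refine ⟨LinearMap.pi φ, fun f hf hfN ↦ ?_⟩
  calc ∑ l, n l
      ≤ ∑ l, ((φ l f).rank +
          if l ∈ S then finrank F (LinearMap.ker (skewEval σ (a l) f)) else 0) :=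
        Finset.sum_le_sum fun l _ ↦ hφ l f hf hfN
    _ = srk (LinearMap.pi φ f : MatTuple F m n) +
          ∑ l ∈ S, finrank F (LinearMap.ker (skewEval σ (a l) f)) := by
        rw [Finset.sum_add_distrib, Finset.sum_ite_mem, Finset.univ_inter]
        rfl
    _ ≤ _ := Nat.add_le_add_left (sum_finrank_ker_skewEval_le_natDegree
        (fun _ ↦ mem_range_algebraMap_of_frobenius_eq) (fun l _ ↦ ha0 l) hconj hf) _

theorem encodedCode_mono (E : K[X] →ₗ[F] MatTuple F m n) : Monotone (encodedCode E) :=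
  fun _ _ h ↦ Submodule.map_mono (degreeLT_mono h)

variable {E : K[X] →ₗ[F] MatTuple F m n} {N s : ℕ}

theorem IsSumRankEncoder.lt_srk_add (hE : IsSumRankEncoder E N) (hs : s ≤ N)
    {X : MatTuple F m n} (hX : X ∈ encodedCode E s) (hX0 : X ≠ 0) :
    ∑ l, n l < srk X + s := by
  obtain ⟨f, hf, rfl⟩ := hX
  have hf0 : f ≠ 0 := fun h ↦ hX0 (by rw [h, map_zero])
  have hdeg : f.natDegree < s := (natDegree_lt_iff_degree_lt hf0).mpr (mem_degreeLT.mp hf)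
  have := hE f hf0 (hdeg.trans_le hs)
  omega

theorem IsSumRankEncoder.finrank_encodedCode (hE : IsSumRankEncoder E N) (hN : N ≤ ∑ l, n l)
    (hs : s ≤ N) : finrank F (encodedCode E s) = finrank F K * s := by
  have hinj : Function.Injective (E.domRestrict ((degreeLT K s).restrictScalars F)) := by
    refine (injective_iff_map_eq_zero _).mpr fun f hf ↦ ?_
    by_contra hf0
    have hf0' : f.1 ≠ 0 := fun h ↦ hf0 (Subtype.ext h)
    have hdeg : f.1.natDegree < s := (natDegree_lt_iff_degree_lt hf0').mpr (mem_degreeLT.mp f.2)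
    have hdefect := hE f.1 hf0' (hdeg.trans_le hs)
    have hsrk : srk (E f.1) = 0 := by rw [show E f.1 = 0 from hf]; simp [srk]
    omega
  rw [encodedCode, ← LinearMap.range_domRestrict, LinearMap.finrank_range_of_inj hinj,
    finrank_degreeLT]

end Encoder

section Singleton

variable {F : Type*} [Field F] {t : ℕ} {m n : Fin t → ℕ}

theorem rank_le_card_of_col_eq_zero {p q : Type*} [Fintype q] (A : Matrix p q F)
    {T : Finset q} (hT : ∀ c ∉ T, A.col c = 0) : A.rank ≤ T.card := by
  classical
  have hspan : Submodule.span F (Set.range A.col) ≤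
      Submodule.span F (T.image A.col : Finset (p → F)) := by
    refine Submodule.span_le.mpr ?_
    rintro _ ⟨c, rfl⟩
    by_cases hc : c ∈ T
    · exact Submodule.subset_span (Finset.mem_coe.mpr (Finset.mem_image_of_mem _ hc))
    · rw [hT c hc]
      exact Submodule.zero_mem _
  rw [A.rank_eq_finrank_span_cols]
  exact (Submodule.finrank_mono hspan).trans
    ((finrank_span_finset_le_card _).trans Finset.card_image_le)

theorem srk_add_card_le_of_col_eq_zero {X : MatTuple F m n} {S : Finset (Σ l, Fin (n l))}
    (hX : ∀ c ∈ S, (X c.1).col c.2 = 0) : srk X + S.card ≤ ∑ l, n l := by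
  classical
  let T : (l : Fin t) → Finset (Fin (n l)) := fun l ↦ {c | ⟨l, c⟩ ∈ S}
  have hcard : S.card = ∑ l, (T l).card := by
    rw [← Finset.card_sigma]
    congr 1
    ext ⟨l, c⟩
    simp [T]
  rw [srk, hcard, ← Finset.sum_add_distrib]
  refine Finset.sum_le_sum fun l _ ↦ ?_
  have hrank := rank_le_card_of_col_eq_zero (X l) (T := (T l)ᶜ) fun c hc ↦
    hX ⟨l, c⟩ (by simpa [T] using hc)
  have hcompl := (T l).card_compl_add_card
  rw [Fintype.card_fin] at hcompl
  omega

theorem exists_mem_srk_add_card_le (C : Submodule F (MatTuple F m n))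
    {S : Finset (Σ l, Fin (n l))} (hS : ∑ c ∈ S, m c.1 < finrank F C) :
    ∃ X ∈ C, X ≠ 0 ∧ srk X + S.card ≤ ∑ l, n l := by
  let columns : C →ₗ[F] ((c : S) → Fin (m c.1.1) → F) :=
    { toFun X c := (X.1 c.1.1).col c.1.2
      map_add' _ _ := rfl
      map_smul' _ _ := rfl }
  have hlt : finrank F ((c : S) → Fin (m c.1.1) → F) < finrank F C := by
    rw [finrank_pi_fintype]
    simpa only [finrank_fin_fun, Finset.sum_coe_sort S (fun c ↦ m c.1)] using hS
  obtain ⟨X, hX, hX0⟩ := Submodule.exists_mem_ne_zero_of_ne_bot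
    (LinearMap.ker_ne_bot_of_finrank_lt (f := columns) hlt)
  exact ⟨X, X.2, fun h ↦ hX0 (Subtype.ext h), srk_add_card_le_of_col_eq_zero fun c hc ↦
    congrFun (LinearMap.mem_ker.mp hX) ⟨c, hc⟩⟩

theorem minDist_eq_of_forall_le_of_exists {C : Submodule F (MatTuple F m n)} {i : ℕ}
    (hle : ∀ X ∈ C, X ≠ 0 → i ≤ srk X) (hex : ∃ X ∈ C, X ≠ 0 ∧ srk X ≤ i) : minDist C = i := by
  obtain ⟨X, hX, hX0, hXi⟩ := hex
  have hmem : srk X ∈ {w | ∃ X ∈ C, X ≠ 0 ∧ srk X = w} := ⟨X, hX, hX0, rfl⟩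
  refine le_antisymm ((Nat.sInf_le hmem).trans hXi) (le_csInf ⟨_, hmem⟩ ?_)
  rintro _ ⟨Y, hY, hY0, rfl⟩
  exact hle Y hY hY0

theorem minDist_bot : minDist (⊥ : Submodule F (MatTuple F m n)) = 0 := by
  simp [minDist]

theorem sum_Iio_add_sum_Ici (n : Fin t → ℕ) (k : Fin t) :
    ∑ l ∈ Finset.Iio k, n l + ∑ l ∈ Finset.Ici k, n l = ∑ l, n l := by
  rw [← Finset.sum_add_sum_compl (Finset.Iio k)]
  congr 2
  ext l
  simp

theorem minDist_eq_of_lt_finrank {C : Submodule F (MatTuple F m n)} {j : Fin t} {i : ℕ}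
    (hj : ∀ l, j ≤ l → m l = m j) (hi : ∑ l ∈ Finset.Iio j, n l ≤ i)
    (hC : m j * (∑ l, n l - i) < finrank F C) (hle : ∀ X ∈ C, X ≠ 0 → i ≤ srk X) :
    minDist C = i := by
  have hsplit := sum_Iio_add_sum_Ici n j
  obtain ⟨S, hSj, hScard⟩ := Finset.exists_subset_card_eq
    (s := (Finset.Ici j).sigma fun l ↦ (Finset.univ : Finset (Fin (n l))))
    (n := ∑ l, n l - i) <| by
      simp only [Finset.card_sigma, Finset.card_univ, Fintype.card_fin]
      omega
  have hentries : ∑ c ∈ S, m c.1 = m j * (∑ l, n l - i) := by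
    rw [Finset.sum_congr rfl fun c hc ↦ hj _ (by simpa using hSj hc), Finset.sum_const, hScard,
      smul_eq_mul, mul_comm]
  obtain ⟨X, hX, hX0, hXS⟩ := exists_mem_srk_add_card_le C (hentries.trans_lt hC)
  have := hle X hX hX0
  exact minDist_eq_of_forall_le_of_exists hle ⟨X, hX, hX0, by omega⟩

theorem exists_eq_sum_Iio_add (n : Fin t → ℕ) {i : ℕ} (hi : i < ∑ l, n l) :
    ∃ (k : Fin t) (ε : ℕ), ε < n k ∧ i = ∑ l ∈ Finset.Iio k, n l + ε := by
  obtain ⟨⟨k, ε⟩, hkε⟩ := finSigmaFinEquiv.surjective (⟨i, hi⟩ : Fin (∑ l, n l))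
  refine ⟨k, ε, ε.2, ?_⟩
  have hval := congrArg Fin.val hkε
  rw [finSigmaFinEquiv_apply] at hval
  have hIio : Finset.Iio k = Finset.univ.map (Fin.castLEEmb k.2.le) := by
    ext l
    simp only [Finset.mem_Iio, Finset.mem_map, Finset.mem_univ, true_and]
    exact ⟨fun hl ↦ ⟨⟨l, hl⟩, rfl⟩, by rintro ⟨x, rfl⟩; exact x.2⟩
  rw [hIio, Finset.sum_map]
  exact hval.symm

theorem isMSRD_of_minDist_eq {C : Submodule F (MatTuple F m n)} {j : Fin t} {i : ℕ}
    (hj : ∀ l, j ≤ l → m l = m j) (hji : ∑ l ∈ Finset.Iio j, n l < i) (hi : i ≤ ∑ l, n l)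
    (hmin : minDist C = i) (hC : finrank F C = m j * (∑ l, n l - i + 1)) : IsMSRD C := by
  refine ⟨?_, ?_⟩
  · rintro rfl
    rw [minDist_bot] at hmin
    omega
  obtain ⟨k, ε, hε, hik⟩ := exists_eq_sum_Iio_add n (i := i - 1) (by omega)
  have hjk : j ≤ k := by
    by_contra! hkj
    have hmono : ∑ l ∈ Finset.Iic k, n l ≤ ∑ l ∈ Finset.Iio j, n l :=
      Finset.sum_le_sum_of_subset fun l hl ↦
        Finset.mem_Iio.mpr ((Finset.mem_Iic.mp hl).trans_lt hkj)
    rw [← Finset.sum_Iio_add_eq_sum_Iic] at hmono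
    omega
  refine ⟨k, ε, hε, by omega, ?_⟩
  have hsplit := sum_Iio_add_sum_Ici n k
  calc finrank F C + ε * m k = m j * (∑ l, n l - i + 1 + ε) := by rw [hC, hj k hjk]; ring
    _ = m j * ∑ l ∈ Finset.Ici k, n l := by congr 1; omega
    _ = ∑ l ∈ Finset.Ici k, m l * n l := by
      rw [Finset.mul_sum]
      exact Finset.sum_congr rfl fun l hl ↦ by rw [hj l (hjk.trans (Finset.mem_Ici.mp hl))]

end Singleton

theorem proposition4p12_general {F : Type*} [Field F] [Fintype F] {t : ℕ} {m n : Fin t → ℕ}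
    (hnm : ∀ l, n l ≤ m l) {j : Fin t} (hmin : ∀ l, m j ≤ m l) (hj : ∀ l, j ≤ l → m l = m j)
    {δ : ℕ} (hδ : δ < n j) {S : Finset (Fin t)} (hS : ∀ l ∈ S, n l ≤ m j)
    (hSc : ∀ l ∉ S, m j * ((∑ i ∈ Finset.Ici j, n i) - δ) ≤ m l)
    (hcard : S.card < Fintype.card F) :
    ∃ C : ℕ → Submodule F (MatTuple F m n), Antitone C ∧
      ∀ i, ∑ l ∈ Finset.Iio j, n l + δ < i → i ≤ ∑ l, n l → IsMSRD (C i) ∧ minDist (C i) = i := by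
  have hmj : m j ≠ 0 := by have := hnm j; omega
  obtain ⟨K, _, _, _, hK⟩ := exists_finiteField_extension_finrank_eq F hmj
  obtain ⟨E, hE⟩ := exists_isSumRankEncoder (K := K) (m := m) hcard
    (fun l hl ↦ hK.symm ▸ ⟨hS l hl, hmin l⟩) (fun l hl ↦ ⟨hnm l, hK.symm ▸ hSc l hl⟩)
  have hsplit := sum_Iio_add_sum_Ici n j
  refine ⟨fun i ↦ encodedCode E (∑ l, n l - i + 1), fun i k hik ↦ encodedCode_mono E (by omega),
    fun i hji hi ↦ ?_⟩
  have hsN : ∑ l, n l - i + 1 ≤ (∑ l ∈ Finset.Ici j, n l) - δ := by omega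
  have hfin := hE.finrank_encodedCode (by omega) hsN
  rw [hK] at hfin
  have hdist : minDist (encodedCode E (∑ l, n l - i + 1)) = i :=
    minDist_eq_of_lt_finrank hj (by omega)
      (by rw [hfin]; exact Nat.mul_lt_mul_of_pos_left (Nat.lt_succ_self _) (Nat.pos_of_ne_zero hmj))
      fun X hX hX0 ↦ by have := hE.lt_srk_add hsN hX hX0; omega
  exact ⟨isMSRD_of_minDist_eq hj (by omega) hi hdist hfin, hdist⟩

theorem proposition4p12 {F : Type*} [Field F] [Fintype F]
    {t : ℕ} (ht : 0 < t) (m n : Fin t → ℕ)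
    (hm : Antitone m) (hn : ∀ i, 0 < n i) (hnm : ∀ i, n i ≤ m i)
    (j : Fin t) (hj : IsLeast {i : Fin t | m i = m ⟨t - 1, Nat.sub_one_lt_of_lt ht⟩} j)
    (δ : ℕ) (hδ : δ < n j)
    (d : ℕ) (hd : d = (∑ i ∈ Finset.Iio j, n i) + δ + 1)
    (h : Fin t) (hh : IsGreatest {i : Fin t | m ⟨t - 1, Nat.sub_one_lt_of_lt ht⟩ < n i} h)
    (hmh : m ⟨t - 1, Nat.sub_one_lt_of_lt ht⟩ * ((∑ i ∈ Finset.Ici j, n i) - δ) ≤ m h)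
    -- blocks are numbered from 0 here, so the one-based index of the block `h` is `h + 1`
    (hq : t - ((h : ℕ) + 1) < Fintype.card F) :
    ∃ C : ℕ → Submodule F (MatTuple F m n),
      (∀ i, d ≤ i → i ≤ ∑ l, n l → IsMSRD (C i) ∧ minDist (C i) = i) ∧
      (∀ i k, d ≤ i → i ≤ k → k ≤ ∑ l, n l → C k ≤ C i) := by
  have hle : ∀ i : Fin t, i ≤ ⟨t - 1, Nat.sub_one_lt_of_lt ht⟩ := fun i ↦ Nat.le_sub_one_of_lt i.2
  rw [← hj.1] at hmh
  obtain ⟨C, hanti, hC⟩ := proposition4p12_general (F := F) hnm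
    (fun i ↦ hj.1.trans_le (hm (hle i)))
    (fun i hi ↦ le_antisymm (hm hi) (hj.1.trans_le (hm (hle i)))) hδ (S := Finset.Ioi h)
    (fun i hi ↦ not_lt.mp fun hlt ↦ (hh.2 (hj.1 ▸ hlt)).not_gt (Finset.mem_Ioi.mp hi))
    (fun i hi ↦ hmh.trans (hm (not_lt.mp fun hlt ↦ hi (Finset.mem_Ioi.mpr hlt))))
    (by rw [Fin.card_Ioi]; omega)
  exact ⟨C, fun i hdi hi ↦ hC i (by omega) hi, fun i k _ hik _ ↦ hanti hik⟩
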